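/- Let $d \ge 0$ be an integer. For an integer $N \ge 3$ let $T^d_N$ be the $d$-dimensional discrete torus, i.e. the Cayley graph of the group $(\mathbb{Z}/N\mathbb{Z})^d$ with respect to the generating set $\{\pm e_1,\dots,\pm e_d\}$, where $e_i$ has $1$ in the $i$-th coordinate and $0$ elsewhere. List the eigenvalues of the adjacency matrix of $T^d_N$ with multiplicity in non-increasing order, $\mu_1 \ge \mu_2 \ge \cdots \ge \mu_{N^d}$, and for an eigenvalue $\mu$ let $m_{T^d_N}(\mu)$ denote its multiplicity, i.e. the dimension of the corresponding eigenspace. There exist constants $c_d$ with $0 < c_d \le \tfrac12$ and $C_d$, depending only on $d$, such that for every $N \ge 3$ and every integer $k$ with $1 \le k < c_d N^d$ or $(1-c_d)N^d < k \le N^d$, one has $m_{T^d_N}(\mu_k) \le C_d$. -/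

import Mathlib

/-- The discrete torus `T^d_N`: the Cayley graph of the group `(ℤ/Nℤ)^d` with respect to the
generating set `{±e_1, …, ±e_d}`, where `e_i` has `1` in coordinate `i` and `0` elsewhere. -/
def discreteTorus (d N : ℕ) : SimpleGraph (Fin d → ZMod N) :=
  SimpleGraph.addCayley
    {s | ∃ i : Fin d, s = Pi.single i (1 : ZMod N) ∨ s = -Pi.single i (1 : ZMod N)}

open scoped Classical in
/-- The adjacency matrix of `T^d_N`, with real entries. -/
noncomputable def torusMatrix (d N : ℕ) :
    Matrix (Fin d → ZMod N) (Fin d → ZMod N) ℝ :=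
  (discreteTorus d N).adjMatrix ℝ

theorem torusMatrix_isHermitian (d N : ℕ) : (torusMatrix d N).IsHermitian :=
  by
  classical
  exact SimpleGraph.isHermitian_adjMatrix ℝ (discreteTorus d N)

theorem card_torus (d N : ℕ) [NeZero N] : Fintype.card (Fin d → ZMod N) = N ^ d := by
  simp [ZMod.card]

/-- The eigenvalues of (the adjacency matrix of) `T^d_N`, listed with multiplicity in
non-increasing order `μ_1 ≥ μ_2 ≥ ⋯ ≥ μ_{N^d}`. The index is zero-based: the value at
`⟨k - 1, _⟩` is `μ_k`. -/
noncomputable def torusEigenvalue (d N : ℕ) [NeZero N] (j : Fin (N ^ d)) : ℝ :=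
  (torusMatrix_isHermitian d N).eigenvalues₀ (Fin.cast (card_torus d N).symm j)

/-- The multiplicity `m_{T^d_N}(μ)`: the dimension of the `μ`-eigenspace of the adjacency
matrix. -/
noncomputable def torusMultiplicity (d N : ℕ) [NeZero N] (μ : ℝ) : ℕ :=
  Module.finrank ℝ (Module.End.eigenspace (Matrix.toLin' (torusMatrix d N)) μ)

/-!
The eigenvalue of the torus at a frequency `y` is the sum of the `N`-th roots of unity
`χ (± yᵢ)`, where `χ t = exp (2πi t / N)`. An eigenvalue near the end `2d σ` of the spectrum,
`σ = ± 1`, forces all these roots to be close to `σ`; equality of two such eigenvalues is a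
rational relation between at most `4d` roots of unity near `σ`. By an argument of Mann, `k` roots
of unity whose powers with exponent `∏_{p ≤ k} p` are distinct are linearly independent over `ℚ`:
if their order divides `n = p m` with `p ∣ m` or `p > k`, at least `k` conjugations of the form
`z ↦ z ^ (1 + l m)` with consecutive `l` are available, and a Vandermonde argument splits the
relation according to the value of `z ^ m`, which reduces `n` to `m`. Hence the eigenvalue
determines the frequencies `± yᵢ` as a multiset, so its multiplicity is at most `(2d) ^ d`. Finally,
a positive proportion of all frequencies has every `χ (yᵢ)` close to `σ`, so a positive proportion
of the ordered spectrum at each end consists of eigenvalues of this kind.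
-/

open Finset

theorem sum_filter_eq_zero_of_forall_sum_mul_pow_eq_zero {ι K : Type*} [Field K] [DecidableEq K]
    (s : Finset ι) (b w : ι → K) (h : ∀ j < #s, ∑ i ∈ s, b i * w i ^ j = 0)
    {i₀ : ι} (hi₀ : i₀ ∈ s) : ∑ i ∈ s with w i = w i₀, b i = 0 := by
  set P := Lagrange.basis (s.image w) id (w i₀)
  have hmem : ∀ i ∈ s, w i ∈ s.image w := fun i hi => mem_image_of_mem w hi
  have hdeg : P.natDegree < #s := by
    rw [Lagrange.natDegree_basis (Set.injOn_id _) (hmem i₀ hi₀)]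
    exact (Nat.sub_one_lt_of_lt (card_pos.2 ⟨_, hmem i₀ hi₀⟩)).trans_le card_image_le
  have hP : ∀ i ∈ s, P.eval (w i) = if w i = w i₀ then 1 else 0 := by
    intro i hi
    split_ifs with hw
    · rw [hw]
      exact Lagrange.eval_basis_self (Set.injOn_id _) (hmem i₀ hi₀)
    · exact Lagrange.eval_basis_of_ne (v := id) (Ne.symm hw) (hmem i hi)
  calc ∑ i ∈ s with w i = w i₀, b i = ∑ i ∈ s, b i * P.eval (w i) := by
        rw [sum_filter]
        exact sum_congr rfl fun i hi => by rw [hP i hi, mul_ite, mul_one, mul_zero]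
    _ = ∑ j ∈ range #s, P.coeff j * ∑ i ∈ s, b i * w i ^ j := by
        simp only [Polynomial.eval_eq_sum_range' hdeg, mul_sum]
        rw [sum_comm]
        exact sum_congr rfl fun j _ => sum_congr rfl fun i _ => mul_left_comm _ _ _
    _ = 0 := sum_eq_zero fun j hj => by rw [h j (mem_range.1 hj), mul_zero]

section RootsOfUnity

variable {ι K : Type*} [Field K] [CharZero K] {ζ : K} {n : ℕ}

theorem sum_smul_pow_eq_zero_of_coprime (hζ : IsPrimitiveRoot ζ n) (hn : 0 < n) (s : Finset ι)
    (a : ι → ℚ) (z : ι → K) (hz : ∀ i ∈ s, z i ^ n = 1) (h : ∑ i ∈ s, a i • z i = 0)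
    {u : ℕ} (hu : u.Coprime n) : ∑ i ∈ s, a i • z i ^ u = 0 := by
  have : NeZero n := ⟨hn.ne'⟩
  choose! e he using fun i hi => (hζ.eq_pow_of_pow_eq_one (hz i hi)).imp fun _ => And.right
  let F : Polynomial ℚ := ∑ i ∈ s, Polynomial.C (a i) * Polynomial.X ^ e i
  have hF : ∀ x : K, Polynomial.aeval x F = ∑ i ∈ s, a i • x ^ e i := fun x => by
    simp [F, Algebra.smul_def]
  have hroot : Polynomial.aeval ζ F = 0 := by
    rw [hF, ← h]
    exact sum_congr rfl fun i hi => by rw [he i hi]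
  have hconj : minpoly ℚ (ζ ^ u) = minpoly ℚ ζ := by
    rw [← Polynomial.cyclotomic_eq_minpoly_rat (hζ.pow_of_coprime u hu) hn,
      Polynomial.cyclotomic_eq_minpoly_rat hζ hn]
  have hroot' : Polynomial.aeval (ζ ^ u) F = 0 :=
    Polynomial.aeval_eq_zero_of_dvd_aeval_eq_zero (hconj ▸ minpoly.dvd ℚ ζ hroot)
      (minpoly.aeval _ _)
  rw [hF] at hroot'
  rw [← hroot']
  exact sum_congr rfl fun i hi => by rw [← he i hi, pow_right_comm]

theorem exists_forall_lt_coprime {p m k : ℕ} (hp : p.Prime) (h : p ∣ m ∨ k < p) :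
    ∃ l, ∀ j < k, (1 + (l + j) * m).Coprime (p * m) := by
  suffices ∃ l, ∀ j < k, ¬ p ∣ 1 + (l + j) * m from this.imp fun l hl j hj =>
    Nat.Coprime.mul_right ((hp.coprime_iff_not_dvd.2 (hl j hj)).symm) (by simp)
  by_cases hpm : p ∣ m
  · exact ⟨0, fun j _ hdvd =>
      hp.one_lt.ne' (Nat.dvd_one.1 ((Nat.dvd_add_left (hpm.mul_left _)).1 hdvd))⟩
  · -- Only one residue class of `l` modulo `p` is bad, so we start right after it.
    obtain ⟨l, hl⟩ : ∃ l, p ∣ 1 + l * m := by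
      have : Fact p.Prime := ⟨hp⟩
      have hm : (m : ZMod p) ≠ 0 := by rwa [Ne, ZMod.natCast_eq_zero_iff]
      refine ⟨(-(m : ZMod p)⁻¹).val, (ZMod.natCast_eq_zero_iff _ _).1 ?_⟩
      simp [hm]
    refine ⟨l + 1, fun j hj hdvd => ?_⟩
    have hsplit : 1 + (l + 1 + j) * m = 1 + l * m + (j + 1) * m := by ring
    rw [hsplit, Nat.dvd_add_right hl, hp.dvd_mul, or_iff_left hpm] at hdvd
    have := Nat.le_of_dvd j.succ_pos hdvd
    have := h.resolve_left hpm
    omega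

theorem sum_filter_pow_eq_zero [DecidableEq K] {p m : ℕ} (hp : p.Prime) (hm : 0 < m)
    (hζ : IsPrimitiveRoot ζ (p * m)) {s : Finset ι} (hpm : p ∣ m ∨ #s < p) {a : ι → ℚ} {z : ι → K}
    (hz : ∀ i ∈ s, z i ^ (p * m) = 1) (h : ∑ i ∈ s, a i • z i = 0) {i₀ : ι} (hi₀ : i₀ ∈ s) :
    ∑ i ∈ s with z i ^ m = z i₀ ^ m, a i • z i = 0 := by
  obtain ⟨l, hl⟩ := exists_forall_lt_coprime hp hpm
  have hz₀ : z i₀ ≠ 0 := (IsUnit.of_pow_eq_one (hz i₀ hi₀) (by positivity [hp.pos])).ne_zero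
  have hconj : ∀ j < #s, ∑ i ∈ s, (a i • z i * (z i ^ m) ^ l) * (z i ^ m) ^ j = 0 := fun j hj => by
    rw [← sum_smul_pow_eq_zero_of_coprime hζ (Nat.mul_pos hp.pos hm) s a z hz h (hl j hj)]
    exact sum_congr rfl fun i _ => by simp only [smul_mul_assoc]; ring_nf
  have hclass := sum_filter_eq_zero_of_forall_sum_mul_pow_eq_zero s _ _ hconj hi₀
  rw [sum_congr rfl fun i hi => by rw [(mem_filter.1 hi).2], ← sum_mul] at hclass
  exact (mul_eq_zero.1 hclass).resolve_right (pow_ne_zero _ (pow_ne_zero _ hz₀))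

theorem exists_prime_mul_eq_of_not_dvd_primorial {n k : ℕ} (hn : ¬ n ∣ primorial k) :
    ∃ p m, p.Prime ∧ n = p * m ∧ (p ∣ m ∨ k < p) := by
  by_contra! hcon
  refine hn ?_
  have hsq : Squarefree n := Nat.squarefree_iff_prime_squarefree.2 fun p hp ⟨m, hm⟩ =>
    (hcon p (p * m) hp (by rw [hm, mul_assoc])).1 (dvd_mul_right p m)
  rw [← Nat.prod_primeFactors_of_squarefree hsq]
  refine prod_primes_dvd _ (fun p hp => (Nat.prime_of_mem_primeFactors hp).prime) fun p hp => ?_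
  obtain ⟨hprime, ⟨m, hm⟩, -⟩ := Nat.mem_primeFactors.1 hp
  exact hprime.dvd_primorial_iff.2 (hcon p m hprime hm).2

/-- A form of Mann's theorem on rational relations between few roots of unity. -/
theorem linearIndepOn_rat_of_injOn_pow_primorial (hζ : IsPrimitiveRoot ζ n) (hn : 0 < n) {k : ℕ}
    {s : Finset ι} {z : ι → K} (hs : #s ≤ k) (hz : ∀ i ∈ s, z i ^ n = 1)
    (hinj : Set.InjOn (fun i => z i ^ primorial k) s) : LinearIndepOn ℚ z s := by
  classical
  induction n using Nat.strong_induction_on generalizing ζ s z with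
  | _ n ih =>
  refine linearIndepOn_finset_iff.2 fun a h i₀ hi₀ => ?_
  have hz₀ : z i₀ ≠ 0 := (IsUnit.of_pow_eq_one (hz i₀ hi₀) hn.ne').ne_zero
  by_cases hnk : n ∣ primorial k
  · have hpow : ∀ i ∈ s, z i ^ primorial k = 1 := fun i hi => by
      obtain ⟨r, hr⟩ := hnk
      rw [hr, pow_mul, hz i hi, one_pow]
    have hsingle : s = {i₀} := eq_singleton_iff_unique_mem.2
      ⟨hi₀, fun i hi => hinj hi hi₀ ((hpow i hi).trans (hpow i₀ hi₀).symm)⟩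
    rw [hsingle, sum_singleton] at h
    exact (smul_eq_zero.1 h).resolve_right hz₀
  · obtain ⟨p, m, hp, rfl, hpm⟩ := exists_prime_mul_eq_of_not_dvd_primorial hnk
    have hm : 0 < m := Nat.pos_of_mul_pos_left hn
    set t := {i ∈ s | z i ^ m = z i₀ ^ m}
    have hts : t ⊆ s := filter_subset _ s
    -- Dividing by `z i₀` turns the class of `z i₀` into `m`-th roots of unity.
    have hindep : LinearIndepOn ℚ (fun i => z i / z i₀) t := by
      refine ih m (lt_mul_of_one_lt_left hm hp.one_lt) (hζ.pow hn rfl) hm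
        ((card_le_card hts).trans hs) (fun i hi => ?_)
        fun i hi j hj hij => hinj (hts hi) (hts hj) ?_
      · rw [div_pow, (mem_filter.1 hi).2, div_self (pow_ne_zero _ hz₀)]
      · simpa only [div_pow, div_left_inj' (pow_ne_zero _ hz₀)] using hij
    refine linearIndepOn_finset_iff.1 hindep a ?_ i₀ (mem_filter.2 ⟨hi₀, rfl⟩)
    simp only [← smul_div_assoc]
    rw [← sum_div, sum_filter_pow_eq_zero hp hm hζ (hpm.imp_right hs.trans_lt) hz h hi₀, zero_div]

end RootsOfUnity

theorem norm_pow_sub_one_le {R : Type*} [NormedRing R] [NormOneClass R] {v : R} (hv : ‖v‖ ≤ 1)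
    (j : ℕ) : ‖v ^ j - 1‖ ≤ j * ‖v - 1‖ := by
  rw [← geom_sum_mul]
  refine (norm_mul_le _ _).trans ?_
  gcongr
  simpa using norm_sum_le_of_le (range j) fun i _ => (norm_pow_le v i).trans
    (pow_le_one₀ (norm_nonneg v) hv)

theorem eq_one_of_pow_eq_one_of_mul_norm_sub_lt_one {v : ℂ} {Q : ℕ} (hQ : Q ≠ 0) (hv : v ^ Q = 1)
    (h : Q * ‖v - 1‖ < 1) : v = 1 := by
  by_contra hne
  have hnorm : ‖v‖ = 1 := Complex.norm_eq_one_of_pow_eq_one hv hQ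
  have hgeom : ∑ j ∈ range Q, v ^ j = 0 := by
    refine (mul_eq_zero.1 ?_).resolve_right (sub_ne_zero.2 hne)
    rw [geom_sum_mul, hv, sub_self]
  have hlt : (Q : ℝ) < Q := calc
    (Q : ℝ) = ‖∑ j ∈ range Q, (v ^ j - 1)‖ := by simp [hgeom]
    _ ≤ ∑ j ∈ range Q, ‖v ^ j - 1‖ := norm_sum_le _ _
    _ ≤ ∑ _i ∈ range Q, Q * ‖v - 1‖ := by
      gcongr with i hi
      exact (norm_pow_sub_one_le hnorm.le _).trans (by gcongr; exact (mem_range.1 hi).le)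
    _ < ∑ _i ∈ range Q, 1 := sum_lt_sum_of_nonempty (nonempty_range_iff.2 hQ) fun _ _ => h
    _ = Q := by simp
  exact hlt.false

theorem eq_of_pow_eq_pow_of_norm_sub_lt {z w c : ℂ} {Q : ℕ} (hQ : Q ≠ 0) (hw : ‖w‖ = 1)
    (h : z ^ Q = w ^ Q) (hzc : ‖z - c‖ < 1 / (2 * Q)) (hwc : ‖w - c‖ < 1 / (2 * Q)) : z = w := by
  have hw₀ : w ≠ 0 := norm_ne_zero_iff.1 (hw ▸ one_ne_zero)
  refine (div_eq_one_iff_eq hw₀).1 (eq_one_of_pow_eq_one_of_mul_norm_sub_lt_one hQ ?_ ?_)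
  · rw [div_pow, h, div_self (pow_ne_zero _ hw₀)]
  · have : (0 : ℝ) < Q := by positivity
    calc Q * ‖z / w - 1‖ = Q * ‖z - w‖ := by rw [div_sub_one hw₀, norm_div, hw, div_one]
      _ ≤ Q * (‖z - c‖ + ‖w - c‖) := by
          gcongr
          simpa only [dist_eq_norm] using dist_triangle_right z w c
      _ < Q * (1 / (2 * Q) + 1 / (2 * Q)) := by gcongr
      _ = 1 := by field_simp; norm_num

theorem eq_of_sum_map_eq_of_linearIndepOn {ι V : Type*} (R : Type*) [Ring R] [CharZero R]
    [AddCommGroup V] [Module R V] [DecidableEq ι] {v : ι → V} {m m' : Multiset ι}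
    (hv : LinearIndepOn R v (m + m').toFinset) (h : (m.map v).sum = (m'.map v).sum) :
    m = m' := by
  have hsum : ∀ a ≤ m + m', (a.map v).sum = ∑ t ∈ (m + m').toFinset, (a.count t : R) • v t := by
    intro a ha
    rw [sum_multiset_map_count]
    simp only [Nat.cast_smul_eq_nsmul]
    exact sum_subset (Multiset.toFinset_subset.2 (Multiset.subset_of_le ha)) fun t _ ht => by
      rw [Multiset.count_eq_zero_of_notMem (mt Multiset.mem_toFinset.2 ht), zero_smul]
  rw [hsum m (Multiset.le_add_right _ _), hsum m' (Multiset.le_add_left _ _), ← sub_eq_zero,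
    ← sum_sub_distrib] at h
  simp only [← sub_smul] at h
  ext t
  by_cases ht : t ∈ (m + m').toFinset
  · exact_mod_cast sub_eq_zero.1 (linearIndepOn_finset_iff.1 hv _ h t ht)
  · rw [Multiset.mem_toFinset, Multiset.mem_add, not_or] at ht
    rw [Multiset.count_eq_zero_of_notMem ht.1, Multiset.count_eq_zero_of_notMem ht.2]

open Polynomial in
theorem charpoly_eq_prod_of_map_mul_eq_mul_diagonal {n R S : Type*} [Fintype n] [DecidableEq n]
    [CommRing R] [CommRing S] {f : R →+* S} (hf : Function.Injective f) {A : Matrix n n R}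
    {U : Matrix n n S} (hU : IsUnit U) {μ : n → R}
    (h : A.map f * U = U * Matrix.diagonal (f ∘ μ)) : A.charpoly = ∏ i, (X - C (μ i)) := by
  obtain ⟨U, rfl⟩ := hU
  apply map_injective f hf
  rw [← Matrix.charpoly_map, (Units.eq_mul_inv_iff_mul_eq U).2 h, Matrix.coe_units_inv,
    Matrix.charpoly_units_conj, Matrix.charpoly_diagonal, Polynomial.map_prod]
  simp

theorem pred_of_lt_card_filter_of_monotone {α : Type*} [Preorder α] {n : ℕ} {f : Fin n → α}
    (hf : Antitone f) {P : α → Prop} [DecidablePred P] (hP : Monotone P) {j : Fin n}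
    (hj : j < #{i | P (f i)}) : P (f j) := by
  by_contra hPj
  have hsub : ({i | P (f i)} : Finset (Fin n)) ⊆ Iio j := fun i hi =>
    mem_Iio.2 <| not_le.1 fun hji => hPj <| hP (hf hji) (mem_filter.1 hi).2
  exact (hj.trans_le (card_le_card hsub)).ne' (Fin.card_Iio j)

theorem pred_of_lt_add_card_filter_of_antitone {α : Type*} [Preorder α] {n : ℕ} {f : Fin n → α}
    (hf : Antitone f) {P : α → Prop} [DecidablePred P] (hP : Antitone P) {j : Fin n}
    (hj : n < j + 1 + #{i | P (f i)}) : P (f j) := by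
  by_contra hPj
  have hsub : ({i | P (f i)} : Finset (Fin n)) ⊆ Ioi j := fun i hi =>
    mem_Ioi.2 <| not_le.1 fun hij => hPj <| hP (hf hij) (mem_filter.1 hi).2
  have := (card_le_card hsub).trans_eq (Fin.card_Ioi j)
  omega

section Spectrum

variable {d N : ℕ}

/-- The neighbour of `x` in the torus in direction `± e_i`, with `true` standing for `+`. -/
def torusStep (x : Fin d → ZMod N) (q : Fin d × Bool) : Fin d → ZMod N :=
  x + Pi.single q.1 (if q.2 then 1 else -1)

theorem torusStep_injective (hN : 3 ≤ N) (x : Fin d → ZMod N) :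
    Function.Injective (torusStep x) := by
  have : Fact (2 < N) := ⟨hN⟩
  have : Fact (1 < N) := ⟨by omega⟩
  rintro ⟨i, b⟩ ⟨i', b'⟩ h
  have hsingle := congrFun (add_left_cancel h) i
  obtain rfl : i = i' := by
    by_contra hne
    cases b <;> simp [Pi.single_eq_of_ne hne] at hsingle
  have hneg : (-1 : ZMod N) ≠ 1 := ZMod.neg_one_ne_one
  cases b <;> cases b' <;> simp_all [eq_comm]

theorem discreteTorus_adj_iff (hN : 3 ≤ N) {x y : Fin d → ZMod N} :
    (discreteTorus d N).Adj x y ↔ y ∈ Set.range (torusStep x) := by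
  have : Fact (1 < N) := ⟨by omega⟩
  have hstep : ∀ i, ∀ s : Bool, torusStep x (i, s) ≠ x := fun i s h => by
    have := congrFun h i
    cases s <;> simp [torusStep] at this
  rw [discreteTorus, SimpleGraph.addCayley_adj']
  constructor
  · rintro ⟨-, g, ⟨i, rfl | rfl⟩, rfl | rfl⟩
    · exact ⟨(i, true), by simp [torusStep]⟩
    · exact ⟨(i, false), by simp [torusStep, Pi.single_neg]⟩
    · exact ⟨(i, false), by simp [torusStep, Pi.single_neg]⟩
    · exact ⟨(i, true), by simp [torusStep]⟩
  · rintro ⟨⟨i, b⟩, rfl⟩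
    refine ⟨(hstep i b).symm, Pi.single i (if b then 1 else -1), ⟨i, ?_⟩, Or.inl rfl⟩
    cases b <;> simp [Pi.single_neg]

theorem sum_neighborFinset_discreteTorus {M : Type*} [AddCommMonoid M] (hN : 3 ≤ N)
    (x : Fin d → ZMod N) [Fintype ((discreteTorus d N).neighborSet x)]
    (f : (Fin d → ZMod N) → M) :
    ∑ w ∈ (discreteTorus d N).neighborFinset x, f w
      = ∑ i, (f (x + Pi.single i 1) + f (x - Pi.single i 1)) := by
  classical
  have hnbr : (discreteTorus d N).neighborFinset x = univ.image (torusStep x) := by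
    ext w
    rw [SimpleGraph.mem_neighborFinset, discreteTorus_adj_iff hN]
    simp
  rw [hnbr, sum_image (torusStep_injective hN x).injOn, Fintype.sum_prod_type]
  simp [torusStep, Pi.single_neg, sub_eq_add_neg]

variable [NeZero N]

/-- The eigenvalue `∑ i, 2 cos (2π yᵢ / N)` of the torus at the frequency `y`, written with the
standard additive character of `ℤ/Nℤ`. -/
noncomputable def torusSymbol (y : Fin d → ZMod N) : ℝ :=
  ∑ i, 2 * (ZMod.stdAddChar (y i)).re

/-- The character `x ↦ exp (2πi ⟨x, y⟩ / N)` of `(ℤ/Nℤ)^d` with frequency `y`. -/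
noncomputable def torusCharacter (y : Fin d → ZMod N) : AddChar (Fin d → ZMod N) ℂ where
  toFun x := ZMod.stdAddChar (x ⬝ᵥ y)
  map_zero_eq_one' := by rw [zero_dotProduct, AddChar.map_zero_eq_one]
  map_add_eq_mul' x x' := by rw [add_dotProduct, AddChar.map_add_eq_mul]

theorem torusCharacter_single (y : Fin d → ZMod N) (i : Fin d) :
    torusCharacter y (Pi.single i 1) = ZMod.stdAddChar (y i) :=
  congrArg ZMod.stdAddChar (single_one_dotProduct i y)

theorem torusCharacter_injective :
    Function.Injective (torusCharacter : (Fin d → ZMod N) → AddChar (Fin d → ZMod N) ℂ) := by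
  refine fun y y' h => funext fun i => ZMod.injective_stdAddChar ?_
  rw [← torusCharacter_single, ← torusCharacter_single, h]

/-- The character table of `(ℤ/Nℤ)^d`, with the frequencies as column indices. -/
noncomputable def characterMatrix (d N : ℕ) [NeZero N] :
    Matrix (Fin d → ZMod N) (Fin d → ZMod N) ℂ :=
  Matrix.of fun x y => torusCharacter y x

theorem isUnit_characterMatrix (d N : ℕ) [NeZero N] : IsUnit (characterMatrix d N) := by
  have hindep : LinearIndependent ℂ fun y : Fin d → ZMod N => (torusCharacter y : _ → ℂ) :=
    (AddChar.linearIndependent (Fin d → ZMod N) ℂ).comp torusCharacter torusCharacter_injective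
  exact Matrix.linearIndependent_cols_iff_isUnit.1 hindep

theorem torusMatrix_map_mul_characterMatrix (hN : 3 ≤ N) :
    (torusMatrix d N).map Complex.ofRealHom * characterMatrix d N
      = characterMatrix d N * Matrix.diagonal (Complex.ofRealHom ∘ torusSymbol) := by
  classical
  ext x y
  have hmap : (torusMatrix d N).map Complex.ofRealHom = (discreteTorus d N).adjMatrix ℂ := by
    ext
    simp [torusMatrix, SimpleGraph.adjMatrix_apply, apply_ite]
  rw [hmap, SimpleGraph.adjMatrix_mul_apply, sum_neighborFinset_discreteTorus hN,
    Matrix.mul_diagonal]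
  simp only [characterMatrix, Matrix.of_apply, Function.comp_apply, torusSymbol, map_sum, mul_sum]
  refine sum_congr rfl fun i _ => ?_
  rw [sub_eq_add_neg, AddChar.map_add_eq_mul, AddChar.map_add_eq_mul, AddChar.map_neg_eq_conj,
    torusCharacter_single, ← mul_add, Complex.add_conj, Complex.ofRealHom_eq_coe]

theorem roots_charpoly_torusMatrix (hN : 3 ≤ N) :
    (torusMatrix d N).charpoly.roots
      = (univ : Finset (Fin d → ZMod N)).val.map torusSymbol := by
  rw [charpoly_eq_prod_of_map_mul_eq_mul_diagonal Complex.ofReal_injective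
    (isUnit_characterMatrix d N) (torusMatrix_map_mul_characterMatrix hN)]
  rw [← Polynomial.roots_multiset_prod_X_sub_C (univ.val.map torusSymbol), Multiset.map_map]
  rfl

theorem torusMultiplicity_le_card (hN : 3 ≤ N) (μ : ℝ) :
    torusMultiplicity d N μ ≤ #{y : Fin d → ZMod N | torusSymbol y = μ} := by
  calc torusMultiplicity d N μ ≤ (torusMatrix d N).charpoly.rootMultiplicity μ :=
        Matrix.charpoly_toLin' (torusMatrix d N) ▸ LinearMap.finrank_eigenspace_le _ μ
    _ = #{y : Fin d → ZMod N | torusSymbol y = μ} := by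
        rw [← Polynomial.count_roots, roots_charpoly_torusMatrix hN, Multiset.count_map]
        simp [card_def, eq_comm]

theorem map_torusEigenvalue (hN : 3 ≤ N) :
    (univ : Finset (Fin (N ^ d))).val.map (torusEigenvalue d N)
      = (univ : Finset (Fin d → ZMod N)).val.map torusSymbol := by
  have hreindex : torusEigenvalue d N =
      (torusMatrix_isHermitian d N).eigenvalues₀ ∘ finCongr (card_torus d N).symm := rfl
  rw [← roots_charpoly_torusMatrix hN,
    (torusMatrix_isHermitian d N).roots_charpoly_eq_eigenvalues₀, hreindex, ← Multiset.map_map,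
    Multiset.map_univ_val_equiv]
  rfl

theorem card_filter_torusEigenvalue (hN : 3 ≤ N) (P : ℝ → Prop) [DecidablePred P] :
    #{j | P (torusEigenvalue d N j)} = #{y : Fin d → ZMod N | P (torusSymbol y)} := by
  have h := congrArg (Multiset.countP P) (map_torusEigenvalue (d := d) hN)
  rwa [Multiset.countP_map, Multiset.countP_map] at h

theorem antitone_torusEigenvalue (d N : ℕ) [NeZero N] : Antitone (torusEigenvalue d N) :=
  fun _ _ h => (torusMatrix_isHermitian d N).eigenvalues₀_antitone h

end Spectrum

section SpectralEnds

variable {d N : ℕ}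

/-- The multiset of all `± xᵢ`, whose character sum is the eigenvalue at the frequency `x`. -/
def signedFrequencies (x : Fin d → ZMod N) : Multiset (ZMod N) :=
  univ.val.map x + univ.val.map (-x)

theorem mem_signedFrequencies {x : Fin d → ZMod N} {t : ZMod N} :
    t ∈ signedFrequencies x ↔ ∃ i, x i = t ∨ -x i = t := by
  simp [signedFrequencies, exists_or]

theorem card_signedFrequencies (x : Fin d → ZMod N) : (signedFrequencies x).card = 2 * d := by
  simp [signedFrequencies, two_mul]

variable [NeZero N]

theorem linearIndepOn_stdAddChar_of_norm_sub_lt {k : ℕ} {s : Finset (ZMod N)} (hs : #s ≤ k) {c : ℂ}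
    (h : ∀ t ∈ s, ‖ZMod.stdAddChar t - c‖ < 1 / (2 * primorial k)) :
    LinearIndepOn ℚ (ZMod.stdAddChar (N := N)) s := by
  refine linearIndepOn_rat_of_injOn_pow_primorial
    (Complex.isPrimitiveRoot_exp N (NeZero.ne N)) (NeZero.pos N) hs (fun t _ => ?_)
    fun t ht u hu htu => ZMod.injective_stdAddChar ?_
  · rw [← AddChar.map_nsmul_eq_pow, nsmul_eq_mul, CharP.cast_eq_zero, zero_mul,
      AddChar.map_zero_eq_one]
  · exact eq_of_pow_eq_pow_of_norm_sub_lt (primorial_pos k).ne' (AddChar.norm_apply _ _) htu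
      (h t ht) (h u hu)

theorem sum_map_stdAddChar_signedFrequencies (x : Fin d → ZMod N) :
    ((signedFrequencies x).map ZMod.stdAddChar).sum = (torusSymbol x : ℂ) := by
  simp only [signedFrequencies, Multiset.map_add, Multiset.sum_add, Multiset.map_map, torusSymbol,
    Complex.ofReal_sum, ← Complex.add_conj, ← AddChar.map_neg_eq_conj, sum_add_distrib]
  rfl

theorem norm_sub_ofReal_sq {z : ℂ} {σ : ℝ} (hz : ‖z‖ = 1) (hσ : |σ| = 1) :
    ‖z - σ‖ ^ 2 = 2 - σ * (2 * z.re) := by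
  rw [← Complex.normSq_eq_norm_sq, Complex.normSq_sub, Complex.normSq_eq_norm_sq, hz,
    Complex.normSq_ofReal, ← abs_mul_abs_self σ, hσ, Complex.conj_ofReal, Complex.re_mul_ofReal]
  ring

theorem two_mul_sub_mul_torusSymbol {σ : ℝ} (hσ : |σ| = 1) (y : Fin d → ZMod N) :
    2 * d - σ * torusSymbol y = ∑ i, ‖ZMod.stdAddChar (y i) - (σ : ℂ)‖ ^ 2 := by
  simp [norm_sub_ofReal_sq (AddChar.norm_apply _ _) hσ, torusSymbol, mul_sum, mul_comm]

theorem norm_stdAddChar_sub_lt_of_mem_signedFrequencies {σ ρ : ℝ} (hσ : |σ| = 1) (hρ : 0 ≤ ρ)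
    {x : Fin d → ZMod N} (h : 2 * d - σ * torusSymbol x < ρ ^ 2) {t : ZMod N}
    (ht : t ∈ signedFrequencies x) : ‖ZMod.stdAddChar t - (σ : ℂ)‖ < ρ := by
  obtain ⟨i, hi⟩ := mem_signedFrequencies.1 ht
  have hxi : ‖ZMod.stdAddChar (x i) - (σ : ℂ)‖ < ρ := by
    rw [two_mul_sub_mul_torusSymbol hσ] at h
    refine lt_of_pow_lt_pow_left₀ 2 hρ (lt_of_le_of_lt ?_ h)
    exact single_le_sum (f := fun i => ‖ZMod.stdAddChar (x i) - (σ : ℂ)‖ ^ 2)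
      (fun _ _ => by positivity) (mem_univ i)
  obtain rfl | rfl := hi
  · exact hxi
  · rwa [AddChar.map_neg_eq_conj, ← Complex.conj_ofReal, ← map_sub, Complex.norm_conj]

theorem signedFrequencies_eq_of_torusSymbol_eq {σ : ℝ} (hσ : |σ| = 1) {x y : Fin d → ZMod N}
    (hx : 2 * d - σ * torusSymbol x < (1 / (2 * primorial (4 * d))) ^ 2)
    (hxy : torusSymbol x = torusSymbol y) : signedFrequencies x = signedFrequencies y := by
  refine eq_of_sum_map_eq_of_linearIndepOn ℚ (v := ZMod.stdAddChar)
    (linearIndepOn_stdAddChar_of_norm_sub_lt (k := 4 * d) (c := σ) ?_ fun t ht => ?_) ?_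
  · refine (Multiset.toFinset_card_le _).trans_eq ?_
    rw [Multiset.card_add, card_signedFrequencies, card_signedFrequencies]
    ring
  · obtain ht | ht := Multiset.mem_add.1 (Multiset.mem_toFinset.1 ht)
    · exact norm_stdAddChar_sub_lt_of_mem_signedFrequencies hσ (by positivity) hx ht
    · exact norm_stdAddChar_sub_lt_of_mem_signedFrequencies hσ (by positivity) (hxy ▸ hx) ht
  · rw [sum_map_stdAddChar_signedFrequencies, sum_map_stdAddChar_signedFrequencies, hxy]

theorem card_torusSymbol_eq_le {σ μ : ℝ} (hσ : |σ| = 1)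
    (hμ : 2 * d - σ * μ < (1 / (2 * primorial (4 * d))) ^ 2) :
    #{y : Fin d → ZMod N | torusSymbol y = μ} ≤ (2 * d) ^ d := by
  obtain hempty | ⟨x, hx⟩ := eq_empty_or_nonempty {y : Fin d → ZMod N | torusSymbol y = μ}
  · simp [hempty]
  obtain rfl := (mem_filter.1 hx).2
  calc #{y : Fin d → ZMod N | torusSymbol y = torusSymbol x}
      ≤ #(Fintype.piFinset fun _ : Fin d => (signedFrequencies x).toFinset) := by
        refine card_le_card fun y hy => Fintype.mem_piFinset.2 fun i => Multiset.mem_toFinset.2 ?_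
        rw [signedFrequencies_eq_of_torusSymbol_eq hσ hμ (mem_filter.1 hy).2.symm]
        exact mem_signedFrequencies.2 ⟨i, Or.inl rfl⟩
    _ ≤ (2 * d) ^ d := by
        rw [Fintype.card_piFinset_const]
        gcongr
        exact (Multiset.toFinset_card_le _).trans_eq (card_signedFrequencies x)

theorem norm_stdAddChar_intCast_sub_le {σ : ℂ} (hσ : ‖σ‖ = 1) (k : ℤ) :
    ‖ZMod.stdAddChar (k : ZMod N) - σ‖ ≤ |2 * Real.pi * k / N - σ.arg| := by
  have hσexp : Complex.exp (σ.arg * .I) = σ := by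
    simpa only [hσ, Complex.ofReal_one, one_mul] using Complex.norm_mul_exp_arg_mul_I σ
  have hchar : ZMod.stdAddChar (k : ZMod N)
      = σ * Complex.exp (.I * (2 * Real.pi * k / N - σ.arg : ℝ)) := calc
    _ = Complex.exp (σ.arg * .I) * Complex.exp (.I * (2 * Real.pi * k / N - σ.arg : ℝ)) := by
      rw [ZMod.stdAddChar_coe, ← Complex.exp_add]
      push_cast
      ring_nf
    _ = _ := by rw [hσexp]
  rw [hchar, ← mul_sub_one, norm_mul, hσ, one_mul]
  exact Real.norm_exp_I_mul_ofReal_sub_one_le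

theorem norm_stdAddChar_intCast_sub_lt {σ : ℂ} (hσ : ‖σ‖ = 1) {ρ : ℝ} {k : ℤ}
    (hle : σ.arg / (2 * Real.pi) * N ≤ k) (hlt : k < (σ.arg + ρ) / (2 * Real.pi) * N) :
    ‖ZMod.stdAddChar (k : ZMod N) - σ‖ < ρ := by
  have hN : (0 : ℝ) < N := Nat.cast_pos.2 (NeZero.pos N)
  have hπ := Real.two_pi_pos
  rw [div_mul_eq_mul_div, div_le_iff₀' hπ, ← le_div_iff₀ hN] at hle
  rw [div_mul_eq_mul_div, lt_div_iff₀' hπ, ← div_lt_iff₀ hN] at hlt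
  refine (norm_stdAddChar_intCast_sub_le hσ k).trans_lt ?_
  rw [abs_of_nonneg (sub_nonneg.2 hle)]
  exact sub_left_lt_of_lt_add hlt

theorem floor_le_card_norm_stdAddChar_sub_lt {σ : ℂ} (hσ : ‖σ‖ = 1) {ρ : ℝ}
    (hρ : ρ ≤ 2 * Real.pi) :
    ⌊ρ / (2 * Real.pi) * N⌋₊ ≤ #{t : ZMod N | ‖ZMod.stdAddChar t - σ‖ < ρ} := by
  have hN : (0 : ℝ) < N := Nat.cast_pos.2 (NeZero.pos N)
  have hπ := Real.two_pi_pos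
  set m := ⌊ρ / (2 * Real.pi) * N⌋₊
  have hmN : m ≤ N := Nat.floor_le_of_le (mul_le_of_le_one_left hN.le ((div_le_one hπ).2 hρ))
  set b := ⌈σ.arg / (2 * Real.pi) * N⌉
  have hinj : Set.InjOn (fun j : ℕ => ((b + j : ℤ) : ZMod N)) (range m) := by
    intro j hj j' hj' h
    have hj := mem_range.1 hj
    have hj' := mem_range.1 hj'
    simp only [Int.cast_add, Int.cast_natCast, add_right_inj] at h
    exact Nat.ModEq.eq_of_lt_of_lt ((ZMod.natCast_eq_natCast_iff _ _ _).1 h) (by omega) (by omega)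
  have hnear : ∀ j ∈ range m, ‖ZMod.stdAddChar ((b + j : ℤ) : ZMod N) - σ‖ < ρ := by
    intro j hj
    have hle : σ.arg / (2 * Real.pi) * N ≤ b := Int.le_ceil _
    have hlt : (b : ℝ) < σ.arg / (2 * Real.pi) * N + 1 := Int.ceil_lt_add_one _
    have hjm : ((j + 1 : ℕ) : ℝ) ≤ ρ / (2 * Real.pi) * N :=
      (Nat.le_floor_iff' j.succ_ne_zero).1 (mem_range.1 hj)
    push_cast at hjm
    refine norm_stdAddChar_intCast_sub_lt hσ ?_ ?_ <;> push_cast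
    · exact hle.trans (le_add_of_nonneg_right j.cast_nonneg)
    · rw [add_div, add_mul]
      linarith
  rw [← card_range m]
  exact card_le_card_of_injOn _ (fun j hj => mem_filter.2 ⟨mem_univ _, hnear j hj⟩) hinj

theorem mul_le_card_norm_stdAddChar_sub_lt {σ : ℂ} (hσ : ‖σ‖ = 1) {ρ : ℝ} (hρ : 0 < ρ)
    (hρπ : ρ ≤ 2 * Real.pi) (hN : 2 * Real.pi / ρ ≤ N) :
    ρ / (4 * Real.pi) * N ≤ #{t : ZMod N | ‖ZMod.stdAddChar t - σ‖ < ρ} := by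
  have hone : 1 ≤ ρ / (2 * Real.pi) * N := by
    rwa [div_mul_eq_mul_div, one_le_div Real.two_pi_pos, ← div_le_iff₀' hρ]
  calc ρ / (4 * Real.pi) * N = ρ / (2 * Real.pi) * N / 2 := by ring
    _ ≤ ⌊ρ / (2 * Real.pi) * N⌋₊ := (Nat.div_two_lt_floor hone).le
    _ ≤ _ := by exact_mod_cast floor_le_card_norm_stdAddChar_sub_lt hσ hρπ

theorem exists_mul_pow_le_card_torusSymbol (d : ℕ) {η : ℝ} (hη : 0 < η) :
    ∃ c : ℝ, 0 < c ∧ ∃ N₀ : ℕ, ∀ (N : ℕ) [NeZero N], N₀ ≤ N → ∀ σ : ℝ, |σ| = 1 →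
      c * N ^ d ≤ #{y : Fin d → ZMod N | 2 * d - σ * torusSymbol y < η} := by
  set ρ : ℝ := min 1 (η / (d + 1))
  have hρ : 0 < ρ := by positivity
  have hρη : d * ρ ^ 2 < η := calc
    d * ρ ^ 2 ≤ d * ρ := by
      gcongr
      exact pow_le_of_le_one hρ.le (min_le_left _ _) two_ne_zero
    _ < (d + 1) * ρ := by gcongr; exact lt_add_one _
    _ ≤ η := (le_div_iff₀' (by positivity)).1 (min_le_right _ _)
  refine ⟨(ρ / (4 * Real.pi)) ^ d, by positivity, ⌈2 * Real.pi / ρ⌉₊, fun N _ hN σ hσ => ?_⟩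
  have hρπ : ρ ≤ 2 * Real.pi := by linarith [min_le_left 1 (η / (d + 1)), Real.pi_gt_three]
  have hcount : ρ / (4 * Real.pi) * N ≤ #{t : ZMod N | ‖ZMod.stdAddChar t - (σ : ℂ)‖ < ρ} :=
    mul_le_card_norm_stdAddChar_sub_lt (by simpa using hσ) hρ hρπ (Nat.ceil_le.1 hN)
  have hsub : (Fintype.piFinset fun _ : Fin d => {t : ZMod N | ‖ZMod.stdAddChar t - (σ : ℂ)‖ < ρ})
      ⊆ ({y | 2 * d - σ * torusSymbol y < η} : Finset (Fin d → ZMod N)) := fun y hy => by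
    have hy : ∀ i, ‖ZMod.stdAddChar (y i) - (σ : ℂ)‖ < ρ := fun i =>
      (mem_filter.1 (Fintype.mem_piFinset.1 hy i)).2
    refine mem_filter.2 ⟨mem_univ _, ?_⟩
    calc 2 * d - σ * torusSymbol y = ∑ i, ‖ZMod.stdAddChar (y i) - (σ : ℂ)‖ ^ 2 :=
          two_mul_sub_mul_torusSymbol hσ y
      _ ≤ ∑ _i : Fin d, ρ ^ 2 := by gcongr with i; exact (hy i).le
      _ = d * ρ ^ 2 := by simp
      _ < η := hρη
  calc (ρ / (4 * Real.pi)) ^ d * N ^ d = (ρ / (4 * Real.pi) * N) ^ d := (mul_pow _ _ _).symm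
    _ ≤ (#{t : ZMod N | ‖ZMod.stdAddChar t - (σ : ℂ)‖ < ρ} : ℝ) ^ d := by gcongr
    _ = #(Fintype.piFinset fun _ : Fin d =>
          ({t : ZMod N | ‖ZMod.stdAddChar t - (σ : ℂ)‖ < ρ} : Finset _)) := by
        rw [Fintype.card_piFinset_const, Nat.cast_pow]
    _ ≤ _ := by exact_mod_cast card_le_card hsub

theorem exists_forall_torusEigenvalue_near_end (d : ℕ) {η : ℝ} (hη : 0 < η) :
    ∃ c : ℝ, 0 < c ∧ c ≤ 1 / 2 ∧ ∃ N₀ : ℕ, ∀ (N : ℕ) [NeZero N], 3 ≤ N → N₀ ≤ N →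
      ∀ j : Fin (N ^ d), ((j + 1 : ℝ) < c * N ^ d ∨ (1 - c) * N ^ d < (j + 1 : ℝ)) →
        ∃ σ : ℝ, |σ| = 1 ∧ 2 * d - σ * torusEigenvalue d N j < η := by
  obtain ⟨c, hc, N₀, hcard⟩ := exists_mul_pow_le_card_torusSymbol d hη
  refine ⟨min c (1 / 2), by positivity, min_le_right _ _, N₀, fun N _ hN hN₀ j hj => ?_⟩
  have hcount : ∀ σ : ℝ, |σ| = 1 →
      min c (1 / 2) * N ^ d ≤ #{j | 2 * d - σ * torusEigenvalue d N j < η} := by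
    intro σ hσ
    rw [card_filter_torusEigenvalue hN fun μ => 2 * d - σ * μ < η]
    exact le_trans (by gcongr; exact min_le_left _ _) (hcard N hN₀ σ hσ)
  obtain hj | hj := hj
  · refine ⟨1, abs_one, pred_of_lt_card_filter_of_monotone (antitone_torusEigenvalue d N)
      (P := fun μ => 2 * d - 1 * μ < η) (fun μ ν hμν => lt_of_le_of_lt (by gcongr)) ?_⟩
    have := hj.trans_le (hcount 1 abs_one)
    exact Nat.lt_of_succ_lt (by exact_mod_cast this)
  · have habs : |(-1 : ℝ)| = 1 := by rw [abs_neg, abs_one]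
    refine ⟨-1, habs, pred_of_lt_add_card_filter_of_antitone (antitone_torusEigenvalue d N)
      (P := fun μ => 2 * d - -1 * μ < η) (fun μ ν hμν => lt_of_le_of_lt (by linarith)) ?_⟩
    have : (N ^ d : ℝ) < j + 1 + #{j | 2 * d - -1 * torusEigenvalue d N j < η} := by
      linarith [hcount (-1) habs]
    exact_mod_cast this

end SpectralEnds

theorem corollary5p5 (d : ℕ) :
    ∃ c : ℝ, 0 < c ∧ c ≤ 1 / 2 ∧ ∃ C : ℕ,
      ∀ (N : ℕ) [NeZero N], 3 ≤ N →
        ∀ (k : ℕ) (hk₁ : 1 ≤ k) (hk₂ : k ≤ N ^ d),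
          ((k : ℝ) < c * (N : ℝ) ^ d ∨ (1 - c) * (N : ℝ) ^ d < (k : ℝ)) →
            torusMultiplicity d N
              (torusEigenvalue d N ⟨k - 1, Nat.sub_one_lt_of_le hk₁ hk₂⟩) ≤ C := by
  have hη : (0 : ℝ) < (1 / (2 * primorial (4 * d))) ^ 2 := by
    have := primorial_pos (4 * d)
    positivity
  obtain ⟨c, hc₀, hc, N₀, hnear⟩ := exists_forall_torusEigenvalue_near_end d hη
  refine ⟨c, hc₀, hc, max (N₀ ^ d) ((2 * d) ^ d), fun N _ hN k hk₁ hk₂ hk => ?_⟩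
  refine (torusMultiplicity_le_card hN _).trans (le_max_iff.2 ?_)
  obtain hN₀ | hN₀ := lt_or_ge N N₀
  · left
    calc _ ≤ Fintype.card (Fin d → ZMod N) := card_le_univ _
      _ = N ^ d := card_torus d N
      _ ≤ N₀ ^ d := by gcongr
  · right
    have hk' : ((k - 1 : ℕ) : ℝ) + 1 = k := by exact_mod_cast Nat.sub_add_cancel hk₁
    obtain ⟨σ, hσ, hlt⟩ := hnear N hN hN₀ ⟨k - 1, Nat.sub_one_lt_of_le hk₁ hk₂⟩ (by rwa [hk'])
    exact card_torusSymbol_eq_le hσ hlt
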